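/- Let $r,m\ge 1$ and let $\boldsymbol\alpha=(\alpha_1,\dots,\alpha_r)$, $\boldsymbol\beta=(\beta_1,\dots,\beta_m)$ be tuples of positive integers such that $\zeta(\boldsymbol\beta)$ is the dual of $\zeta(\boldsymbol\alpha)$, that is, there are $s\ge 1$ and pairs of nonnegative integers $(a_1,b_1),\dots,(a_s,b_s)$ with $$\boldsymbol\alpha=(\{1\}^{a_1},b_1+2,\{1\}^{a_2},b_2+2,\dots,\{1\}^{a_s},b_s+2),$$ $$\boldsymbol\beta=(\{1\}^{b_s},a_s+2,\{1\}^{b_{s-1}},a_{s-1}+2,\dots,\{1\}^{b_1},a_1+2),$$ where $\{c\}^n$ denotes $c$ repeated $n$ times. For tuples $\boldsymbol\gamma=(\gamma_1,\dots,\gamma_p)$ with $p\ge 1$ and $\boldsymbol\delta=(\delta_1,\dots,\delta_q)$ with $q\ge 0$ of positive integers put $$Z_U(\boldsymbol\gamma;\boldsymbol\delta)=\sum_{1\le k_1<\cdots<k_p}k_1^{-\gamma_1}\cdots k_p^{-\gamma_p}\sum_{1\le \ell_1\le\cdots\le \ell_q\le k_p}\ell_1^{-\delta_1}\cdots \ell_q^{-\delta_q},$$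 $$Z_L(\boldsymbol\gamma;\boldsymbol\delta)=\sum_{1\le k_1<\cdots<k_p}k_1^{-\gamma_1}\cdots k_p^{-\gamma_p}\sum_{k_1\le \ell_1\le\cdots\le \ell_q}\ell_1^{-\delta_1}\cdots \ell_q^{-\delta_q},$$ $$Z_B(\boldsymbol\gamma;\boldsymbol\delta)=\sum_{1\le k_1<\cdots<k_p}k_1^{-\gamma_1}\cdots k_p^{-\gamma_p}\sum_{k_1\le \ell_1\le\cdots\le \ell_q\le k_p}\ell_1^{-\delta_1}\cdots \ell_q^{-\delta_q},$$ where for $q=0$ the inner sum is $1$. Then for every integer $n\ge 0$ the series below converge, and $$Z_U(\boldsymbol\alpha;\{2\}^n)=Z_L(\boldsymbol\beta;\{2\}^n)\quad\text{and}\quad Z_B(\boldsymbol\alpha;\{2\}^n)=Z_B(\boldsymbol\beta;\{2\}^n).$$ -/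

import Mathlib

noncomputable section

namespace MZV

/-- The monomial `k₁^{-α₁} ⋯ k_r^{-α_r}` attached to an index `α = (α₁, …, α_r)`. -/
def term (α : List ℕ) (k : Fin α.length → ℕ) : ℝ :=
  ∏ i, ((k i : ℝ) ^ (α.get i))⁻¹

/-- The tuples `1 ≤ k₁ < k₂ < ⋯ < k_r`. -/
def StrictTuples (r : ℕ) : Set (Fin r → ℕ) :=
  {k | (∀ i, 1 ≤ k i) ∧ StrictMono k}

/-- The tuples `1 ≤ ℓ₁ ≤ ℓ₂ ≤ ⋯ ≤ ℓ_m`. -/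
def WeakTuples (m : ℕ) : Set (Fin m → ℕ) :=
  {l | (∀ j, 1 ≤ l j) ∧ Monotone l}

/-- `k₁ ≤ ℓ₁`; no condition if one of the tuples is empty. -/
def FirstLe {r m : ℕ} (k : Fin r → ℕ) (l : Fin m → ℕ) : Prop :=
  ∀ (i : Fin r) (j : Fin m), (i : ℕ) = 0 → (j : ℕ) = 0 → k i ≤ l j

/-- `ℓ_m ≤ k_r`; no condition if one of the tuples is empty. -/
def LastLe {r m : ℕ} (k : Fin r → ℕ) (l : Fin m → ℕ) : Prop :=
  ∀ (i : Fin r) (j : Fin m), (i : ℕ) + 1 = r → (j : ℕ) + 1 = m → l j ≤ k i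

/-- `ℓ`-tuples over which the inner sum of `Z_U` runs: `1 ≤ ℓ₁ ≤ ⋯ ≤ ℓ_m ≤ k_r`. -/
def InnerU {r : ℕ} (m : ℕ) (k : Fin r → ℕ) : Set (Fin m → ℕ) :=
  {l | l ∈ WeakTuples m ∧ LastLe k l}

/-- `ℓ`-tuples over which the inner sum of `Z_L` runs: `k₁ ≤ ℓ₁ ≤ ⋯ ≤ ℓ_m`. -/
def InnerL {r : ℕ} (m : ℕ) (k : Fin r → ℕ) : Set (Fin m → ℕ) :=
  {l | l ∈ WeakTuples m ∧ FirstLe k l}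

/-- `ℓ`-tuples over which the inner sum of `Z_B` runs: `k₁ ≤ ℓ₁ ≤ ⋯ ≤ ℓ_m ≤ k_r`. -/
def InnerB {r : ℕ} (m : ℕ) (k : Fin r → ℕ) : Set (Fin m → ℕ) :=
  {l | l ∈ WeakTuples m ∧ FirstLe k l ∧ LastLe k l}

/-- `Z_U(α; β)`. -/
def ZU (α β : List ℕ) : ℝ :=
  ∑' k : StrictTuples α.length, term α k * ∑' l : InnerU β.length k.1, term β l

/-- `Z_L(α; β)`. -/
def ZL (α β : List ℕ) : ℝ :=
  ∑' k : StrictTuples α.length, term α k * ∑' l : InnerL β.length k.1, term β l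

/-- `Z_B(α; β)`. -/
def ZB (α β : List ℕ) : ℝ :=
  ∑' k : StrictTuples α.length, term α k * ∑' l : InnerB β.length k.1, term β l

/-- The multiple series `Z_U(α; β)` converges (all its terms are nonnegative). -/
def ConvergesU (α β : List ℕ) : Prop :=
  Summable fun p : (k : StrictTuples α.length) × InnerU β.length k.1 =>
    term α p.1 * term β p.2

/-- The multiple series `Z_L(α; β)` converges. -/
def ConvergesL (α β : List ℕ) : Prop :=
  Summable fun p : (k : StrictTuples α.length) × InnerL β.length k.1 =>
    term α p.1 * term β p.2

/-- The multiple series `Z_B(α; β)` converges. -/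
def ConvergesB (α β : List ℕ) : Prop :=
  Summable fun p : (k : StrictTuples α.length) × InnerB β.length k.1 =>
    term α p.1 * term β p.2

/-- `ζ(β)` is the dual of `ζ(α)`: for some pairs `(a₁, b₁), …, (a_s, b_s)` with `s ≥ 1`,
`α = ({1}^{a₁}, b₁ + 2, …, {1}^{a_s}, b_s + 2)` and
`β = ({1}^{b_s}, a_s + 2, …, {1}^{b₁}, a₁ + 2)`. -/
def IsDual (α β : List ℕ) : Prop :=
  ∃ ps : List (ℕ × ℕ), ps ≠ [] ∧
    α = ps.flatMap (fun p => List.replicate p.1 1 ++ [p.2 + 2]) ∧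
    β = ps.reverse.flatMap (fun p => List.replicate p.2 1 ++ [p.1 + 2])

end MZV

end

open scoped ENNReal
open Filter Topology

noncomputable section

namespace MZV

/-! All terms are nonnegative, so the sums are taken in `ℝ≥0∞` and convergence appears as
finiteness. Fix `0 < t < 1/2` and sum over `n` against `t ^ n`. The inner sums over `{2}^n` become
products of `(1 - t/l²)⁻¹` over `l ≤ k_r` for `U`, `l ≥ k₁` for `L` and `k₁ ≤ l ≤ k_r` for `B`. In
terms of `headProd` and `tailProd` they are weights on `k₁` and `k_r` alone.

Duality is proved by connected sums. An index is a word in two letters, "sum `1/k` over larger `k`"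
and "multiply by `1/k`". Against the connector `m! n! / (m + n)!`, a letter acting in `m` equals the
opposite letter acting in `n` (`letterOp_econn`). A whole word therefore crosses over reversed and
with its letters exchanged (`wordOp_econn`), which is the word of the dual index. Weights `φ`, `ψ`
on the smallest indices of the two sides do not interfere (`pairing_wordOp_duality`).

What remains is to sum the connector against a weight. Weight `1` gives `1/n`. Weight `tailProd`
gives `m⁻¹ (headProd (m + 1))⁻¹`, by a Gauss-type summation (`tsum_conn_tailProd`), and this is the
weight of `U` at the largest index. So `φ = 1`, `ψ = tailProd` yields `U = L`, while `φ = ψ =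
tailProd` yields `B = B` up to the common factor `tailProd t 1`. Comparing coefficients
(`coeff_eq_of_genFun_eq`) recovers each `n`. -/

/-- Strictly increasing tuples all of whose entries exceed `b`. -/
def StrictAbove (r b : ℕ) : Set (Fin r → ℕ) := {k | (∀ i, b < k i) ∧ StrictMono k}

/-- Weakly increasing tuples all of whose entries are at least `b`. -/
def WeakAbove (n b : ℕ) : Set (Fin n → ℕ) := {l | (∀ i, b ≤ l i) ∧ Monotone l}

/-- The sum of `k₁^{-α₁} ⋯ k_r^{-α_r} ρ(k_r)` over `b < k₁ < ⋯ < k_r`, with `k_r = b` for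
empty `α`. -/
def nestedSum (ρ : ℕ → ℝ≥0∞) : List ℕ → ℕ → ℝ≥0∞
  | [], b => ρ b
  | a :: α, b => ∑' k : ℕ, if b < k then ENNReal.ofReal ((k : ℝ) ^ a)⁻¹ * nestedSum ρ α k else 0

/-- The sum of `v(l₁) ⋯ v(l_n)` over `b ≤ l₁ ≤ ⋯ ≤ l_n`. -/
def completeSum (v : ℕ → ℝ≥0∞) : ℕ → ℕ → ℝ≥0∞
  | 0, _ => 1
  | n + 1, b => ∑' l : ℕ, if b ≤ l then v l * completeSum v n l else 0

/-! ### Sums over tuples as iterated sums -/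

lemma cons_mem_strictAbove {r b k : ℕ} {x : Fin r → ℕ} :
    (Fin.cons k x : Fin (r + 1) → ℕ) ∈ StrictAbove (r + 1) b ↔ b < k ∧ x ∈ StrictAbove r k := by
  simp only [StrictAbove, Set.mem_ofPred_eq, Fin.forall_fin_succ, Fin.cons_zero, Fin.cons_succ]
  constructor
  · rintro ⟨⟨h0, -⟩, hm⟩
    refine ⟨h0, fun i => ?_, fun i j hij => ?_⟩
    · simpa using hm (Fin.succ_pos i)
    · simpa using hm (Fin.succ_lt_succ_iff.2 hij)
  · rintro ⟨h0, h1, hm⟩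
    refine ⟨⟨h0, fun i => h0.trans (h1 i)⟩, fun i j hij => ?_⟩
    induction j using Fin.cases with
    | zero => exact absurd hij (Fin.not_lt_zero _)
    | succ j =>
      induction i using Fin.cases with
      | zero => simpa using h1 j
      | succ i => simpa using hm (Fin.succ_lt_succ_iff.1 hij)

lemma cons_mem_weakAbove {r b k : ℕ} {x : Fin r → ℕ} :
    (Fin.cons k x : Fin (r + 1) → ℕ) ∈ WeakAbove (r + 1) b ↔ b ≤ k ∧ x ∈ WeakAbove r k := by
  simp only [WeakAbove, Set.mem_ofPred_eq, Fin.forall_fin_succ, Fin.cons_zero, Fin.cons_succ]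
  constructor
  · rintro ⟨⟨h0, -⟩, hm⟩
    refine ⟨h0, fun i => ?_, fun i j hij => ?_⟩
    · simpa using hm (Fin.zero_le i.succ)
    · simpa using hm (Fin.succ_le_succ_iff.2 hij)
  · rintro ⟨h0, h1, hm⟩
    refine ⟨⟨h0, fun i => h0.trans (h1 i)⟩, fun i j hij => ?_⟩
    induction i using Fin.cases with
    | zero =>
      induction j using Fin.cases with
      | zero => simp
      | succ j => simpa using h1 j
    | succ i =>
      induction j using Fin.cases with
      | zero => exact absurd hij (by simp)
      | succ j => simpa using hm (Fin.succ_le_succ_iff.1 hij)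

lemma tsum_fin_succ (r : ℕ) (F : (Fin (r + 1) → ℕ) → ℝ≥0∞) :
    ∑' k, F k = ∑' (k : ℕ) (x : Fin r → ℕ), F (Fin.cons k x) := by
  rw [← (Fin.consEquiv (fun _ : Fin (r + 1) => ℕ)).tsum_eq F, ENNReal.tsum_prod']
  rfl

lemma ofReal_term_cons (a : ℕ) (α : List ℕ) (k : ℕ) (x : Fin α.length → ℕ) :
    ENNReal.ofReal (term (a :: α) (Fin.cons k x)) =
      ENNReal.ofReal ((k : ℝ) ^ a)⁻¹ * ENNReal.ofReal (term α x) := by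
  rw [← ENNReal.ofReal_mul (by positivity)]
  congr 1
  simp only [term]
  exact Fin.prod_univ_succ _

/-- Prepending `b` to `k` gives the empty tuple a last entry, so the induction can start at `α =
[]`. -/
lemma tsum_strictAbove (ρ : ℕ → ℝ≥0∞) (α : List ℕ) (b : ℕ) :
    ∑' k : Fin α.length → ℕ, (StrictAbove α.length b).indicator
      (fun k => ENNReal.ofReal (term α k) *
        ρ ((Fin.cons b k : Fin (α.length + 1) → ℕ) (Fin.last _))) k = nestedSum ρ α b := by
  induction α generalizing b with
  | nil =>
    have : Subsingleton (Fin ([] : List ℕ).length → ℕ) :=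
      inferInstanceAs (Subsingleton (Fin 0 → ℕ))
    rw [tsum_eq_single (fun i => i.elim0) (fun x hx => absurd (Subsingleton.elim _ _) hx)]
    rw [Set.indicator_of_mem]
    · simp [term, nestedSum]
    · exact ⟨fun i => i.elim0, fun i => i.elim0⟩
  | cons a α ih =>
    refine (tsum_fin_succ α.length _).trans ?_
    rw [nestedSum]
    refine tsum_congr fun k => ?_
    split_ifs with hk
    · rw [← ih, ← ENNReal.tsum_mul_left]
      refine tsum_congr fun x => ?_
      by_cases hx : x ∈ StrictAbove α.length k
      · rw [Set.indicator_of_mem hx]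
        refine (Set.indicator_of_mem (cons_mem_strictAbove.2 ⟨hk, hx⟩) _).trans ?_
        rw [ofReal_term_cons, mul_assoc]
        rfl
      · rw [Set.indicator_of_notMem hx, mul_zero]
        exact Set.indicator_of_notMem (fun h => hx (cons_mem_strictAbove.1 h).2) _
    · refine ENNReal.tsum_eq_zero.2 fun x => ?_
      exact Set.indicator_of_notMem (fun h => hk (cons_mem_strictAbove.1 h).1) _

/-- Sums over strict tuples with weights on the smallest and on the largest index. -/
lemma tsum_strictTuples (φ ρ : ℕ → ℝ≥0∞) (a : ℕ) (α : List ℕ) :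
    ∑' k : StrictTuples (a :: α).length, ENNReal.ofReal (term (a :: α) k.1) *
      (φ (k.1 (0 : Fin (α.length + 1))) * ρ (k.1 (Fin.last α.length))) =
    ∑' k : ℕ, if 0 < k then φ k * (ENNReal.ofReal ((k : ℝ) ^ a)⁻¹ * nestedSum ρ α k) else 0 := by
  rw [tsum_subtype (StrictTuples (a :: α).length) (fun k => ENNReal.ofReal (term (a :: α) k) *
      (φ (k (0 : Fin (α.length + 1))) * ρ (k (Fin.last α.length))))]
  refine (tsum_fin_succ α.length _).trans ?_
  refine tsum_congr fun k => ?_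
  have hS : StrictTuples (a :: α).length = StrictAbove (α.length + 1) 0 := rfl
  rw [hS]
  split_ifs with hk
  · rw [← tsum_strictAbove, ← ENNReal.tsum_mul_left, ← ENNReal.tsum_mul_left]
    refine tsum_congr fun x => ?_
    by_cases hx : x ∈ StrictAbove α.length k
    · rw [Set.indicator_of_mem hx, Set.indicator_of_mem (cons_mem_strictAbove.2 ⟨hk, hx⟩),
        ofReal_term_cons, Fin.cons_zero]
      ring
    · rw [Set.indicator_of_notMem hx,
        Set.indicator_of_notMem (fun h => hx (cons_mem_strictAbove.1 h).2), mul_zero, mul_zero]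
  · refine ENNReal.tsum_eq_zero.2 fun x => ?_
    exact Set.indicator_of_notMem (fun h => hk (cons_mem_strictAbove.1 h).1) _

lemma tsum_weakAbove (v : ℕ → ℝ≥0∞) (n b : ℕ) :
    ∑' l : Fin n → ℕ, (WeakAbove n b).indicator (fun l => ∏ j, v (l j)) l =
      completeSum v n b := by
  induction n generalizing b with
  | zero =>
    rw [tsum_eq_single default (fun x hx => absurd (Subsingleton.elim _ _) hx)]
    rw [Set.indicator_of_mem]
    · simp [completeSum]
    · exact ⟨fun i => i.elim0, fun i => i.elim0⟩
  | succ n ih =>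
    rw [tsum_fin_succ, completeSum]
    refine tsum_congr fun k => ?_
    split_ifs with hk
    · rw [← ih, ← ENNReal.tsum_mul_left]
      refine tsum_congr fun x => ?_
      by_cases hx : x ∈ WeakAbove n k
      · rw [Set.indicator_of_mem hx, Set.indicator_of_mem (cons_mem_weakAbove.2 ⟨hk, hx⟩),
          Fin.prod_univ_succ]
        simp
      · rw [Set.indicator_of_notMem hx,
          Set.indicator_of_notMem (fun h => hx (cons_mem_weakAbove.1 h).2), mul_zero]
    · refine ENNReal.tsum_eq_zero.2 fun x => ?_
      exact Set.indicator_of_notMem (fun h => hk (cons_mem_weakAbove.1 h).1) _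

/-! ### The inner sums over tuples of twos -/

/-- `l⁻²` as an extended nonnegative real. -/
def invSq (l : ℕ) : ℝ≥0∞ := ENNReal.ofReal ((l : ℝ) ^ 2)⁻¹

/-- `l⁻²` for `l ≤ m`, and `0` for larger `l`. -/
def invSqLe (m l : ℕ) : ℝ≥0∞ := if l ≤ m then invSq l else 0

lemma ofReal_term_replicate_two (n : ℕ) (l : Fin (List.replicate n 2).length → ℕ) :
    ENNReal.ofReal (term (List.replicate n 2) l) = ∏ j, invSq (l j) := by
  rw [term, ENNReal.ofReal_prod_of_nonneg (fun i _ => by positivity)]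
  refine Finset.prod_congr rfl fun i _ => ?_
  simp [invSq]

/-- By monotonicity, bounding the last entry bounds all of them, so the upper constraint can be
moved into weights vanishing beyond `m`. -/
lemma indicator_weak_le {n r b m : ℕ} {k : Fin (r + 1) → ℕ} (hm : k (Fin.last r) = m)
    (l : Fin n → ℕ) :
    {l | l ∈ WeakAbove n b ∧ LastLe k l}.indicator (fun l => ∏ j, invSq (l j)) l =
      (WeakAbove n b).indicator (fun l => ∏ j, invSqLe m (l j)) l := by
  by_cases hl : l ∈ WeakAbove n b
  · rw [Set.indicator_of_mem hl]
    by_cases h : LastLe k l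
    · rw [Set.indicator_of_mem (show l ∈ {l | _ ∧ _} from ⟨hl, h⟩)]
      refine Finset.prod_congr rfl fun j _ => ?_
      have hj : l j ≤ m := by
        rw [← hm]
        exact (hl.2 (show j ≤ ⟨n - 1, by have := j.2; omega⟩ by
          rw [Fin.le_def]; have := j.2; simp; omega)).trans
          (h (Fin.last r) _ (by simp) (by have := j.2; simp; omega))
      simp [invSqLe, hj]
    · rw [Set.indicator_of_notMem (fun h' => h h'.2)]
      simp only [LastLe, not_forall] at h
      obtain ⟨i, j, hi, hj, hij⟩ := h
      have : i = Fin.last r := Fin.ext (by simp; omega)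
      subst this
      exact (Finset.prod_eq_zero (Finset.mem_univ j) (by simp [invSqLe, ← hm, hij])).symm
  · rw [Set.indicator_of_notMem hl, Set.indicator_of_notMem (fun h => hl h.1)]

lemma weakTuples_firstLe {n r : ℕ} {k : Fin (r + 1) → ℕ} (hk : 1 ≤ k 0) (l : Fin n → ℕ) :
    l ∈ WeakTuples n ∧ FirstLe k l ↔ l ∈ WeakAbove n (k 0) := by
  constructor
  · rintro ⟨⟨h1, hm⟩, hf⟩
    refine ⟨fun j => ?_, hm⟩
    exact (hf 0 ⟨0, by have := j.2; omega⟩ rfl rfl).trans (hm (Fin.le_def.2 (Nat.zero_le _)))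
  · rintro ⟨h1, hm⟩
    refine ⟨⟨fun j => hk.trans (h1 j), hm⟩, fun i j hi _ => ?_⟩
    have : i = 0 := Fin.ext hi
    exact this ▸ h1 j

lemma tsum_innerU {r : ℕ} (k : Fin (r + 1) → ℕ) (n : ℕ) :
    ∑' l : InnerU (List.replicate n 2).length k,
      ENNReal.ofReal (term (List.replicate n 2) l.1) =
        completeSum (invSqLe (k (Fin.last r))) n 1 := by
  simp only [ofReal_term_replicate_two]
  rw [tsum_subtype (InnerU (List.replicate n 2).length k) (fun l => ∏ j, invSq (l j))]
  refine (tsum_congr (indicator_weak_le rfl)).trans ?_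
  rw [tsum_weakAbove, List.length_replicate]

lemma tsum_innerL {r : ℕ} (k : Fin (r + 1) → ℕ) (hk : 1 ≤ k 0) (n : ℕ) :
    ∑' l : InnerL (List.replicate n 2).length k,
      ENNReal.ofReal (term (List.replicate n 2) l.1) = completeSum invSq n (k 0) := by
  simp only [ofReal_term_replicate_two]
  rw [tsum_subtype (InnerL (List.replicate n 2).length k) (fun l => ∏ j, invSq (l j))]
  have : InnerL (List.replicate n 2).length k = WeakAbove (List.replicate n 2).length (k 0) :=
    Set.ext (weakTuples_firstLe hk)
  rw [this, tsum_weakAbove, List.length_replicate]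

lemma tsum_innerB {r : ℕ} (k : Fin (r + 1) → ℕ) (hk : 1 ≤ k 0) (n : ℕ) :
    ∑' l : InnerB (List.replicate n 2).length k,
      ENNReal.ofReal (term (List.replicate n 2) l.1) =
        completeSum (invSqLe (k (Fin.last r))) n (k 0) := by
  simp only [ofReal_term_replicate_two]
  rw [tsum_subtype (InnerB (List.replicate n 2).length k) (fun l => ∏ j, invSq (l j))]
  have : InnerB (List.replicate n 2).length k =
      {l | l ∈ WeakAbove (List.replicate n 2).length (k 0) ∧ LastLe k l} := by
    ext l
    rw [Set.mem_ofPred_eq, ← weakTuples_firstLe hk, and_assoc]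
    rfl
  rw [this]
  refine (tsum_congr (indicator_weak_le rfl)).trans ?_
  rw [tsum_weakAbove, List.length_replicate]

/-! ### Shifted and telescoping series -/

lemma tsum_lt_succ (F : ℕ → ℝ≥0∞) (b : ℕ) :
    (∑' k : ℕ, if b < k then F k else 0) = ∑' i : ℕ, F (b + 1 + i) := by
  rw [← Summable.sum_add_tsum_nat_add' (k := b + 1) ENNReal.summable, Finset.sum_eq_zero, zero_add]
  · refine tsum_congr fun i => ?_
    rw [if_pos (by omega), add_comm]
  · intro k hk
    rw [if_neg (by simp at hk; omega)]

/-- Telescoping series of nonnegative reals, as a sum in `ℝ≥0∞`. -/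
lemma tsum_telescope {F u : ℕ → ℝ} {l : ℝ} (h0 : ∀ i, 0 ≤ F i)
    (h : ∀ i, F i = u i - u (i + 1)) (hu : Tendsto u atTop (𝓝 l)) :
    ∑' i, ENNReal.ofReal (F i) = ENNReal.ofReal (u 0 - l) := by
  have hs : HasSum F (u 0 - l) := by
    rw [hasSum_iff_tendsto_nat_of_nonneg h0]
    simp only [h, Finset.sum_range_sub']
    exact tendsto_const_nhds.sub hu
  rw [← hs.tsum_eq, ENNReal.ofReal_tsum_of_nonneg h0 hs.summable]

/-! ### Generating functions of complete homogeneous sums -/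

lemma completeSum_succ (v : ℕ → ℝ≥0∞) (n b : ℕ) :
    completeSum v (n + 1) b = v b * completeSum v n b + completeSum v (n + 1) (b + 1) := by
  rw [completeSum, completeSum, ENNReal.tsum_eq_add_tsum_ite b, if_pos le_rfl]
  congr 1
  refine tsum_congr fun l => ?_
  by_cases h : l = b
  · simp [h]
  · have : b ≤ l ↔ b + 1 ≤ l := by omega
    simp [h, this]

lemma completeSum_mono {v w : ℕ → ℝ≥0∞} (h : v ≤ w) (n : ℕ) {b c : ℕ} (hbc : b ≤ c) :
    completeSum v n c ≤ completeSum w n b := by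
  induction n generalizing b c with
  | zero => exact le_rfl
  | succ n ih =>
    refine ENNReal.tsum_le_tsum fun l => ?_
    by_cases hl : c ≤ l
    · rw [if_pos hl, if_pos (hbc.trans hl)]
      exact mul_le_mul' (h l) (ih le_rfl)
    · simp [hl]

/-- Forgetting the order of the `l_j` only enlarges the sum. -/
lemma completeSum_le_pow (v : ℕ → ℝ≥0∞) (n b : ℕ) :
    completeSum v n b ≤ completeSum v 1 b ^ n := by
  induction n with
  | zero => simp [completeSum]
  | succ n ih =>
    rw [pow_succ']
    refine le_trans ?_ (mul_le_mul' le_rfl ih)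
    rw [completeSum, completeSum, ← ENNReal.tsum_mul_right]
    refine ENNReal.tsum_le_tsum fun l => ?_
    by_cases hl : b ≤ l
    · simp only [if_pos hl, completeSum, mul_one]
      exact mul_le_mul' le_rfl (completeSum_mono le_rfl n hl)
    · simp [hl]

/-- The generating function `∑ₙ tⁿ h_n(v_b, v_{b+1}, …)`. -/
def genSum (t : ℝ≥0∞) (v : ℕ → ℝ≥0∞) (b : ℕ) : ℝ≥0∞ := ∑' n, t ^ n * completeSum v n b

/-- The factor `1 - t v_b` of the product, written without subtraction; it comes from splitting off
the terms with `l₁ = b`. -/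
lemma genSum_succ (t : ℝ≥0∞) (v : ℕ → ℝ≥0∞) (b : ℕ) :
    genSum t v b = t * v b * genSum t v b + genSum t v (b + 1) := by
  conv_lhs => rw [genSum, tsum_eq_zero_add' ENNReal.summable]
  conv_rhs => rw [genSum, genSum, tsum_eq_zero_add' (f := fun n => t ^ n * completeSum v n (b + 1))
    ENNReal.summable]
  simp only [completeSum_succ v _ b, mul_add, ENNReal.tsum_add, ← ENNReal.tsum_mul_left]
  have : ∀ n, t ^ (n + 1) * (v b * completeSum v n b) = t * v b * (t ^ n * completeSum v n b) :=
    fun n => by ring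
  simp only [this, completeSum]
  ring

lemma genSum_mono (t : ℝ≥0∞) {v w : ℕ → ℝ≥0∞} (h : v ≤ w) {b c : ℕ} (hbc : b ≤ c) :
    genSum t v c ≤ genSum t w b :=
  ENNReal.tsum_le_tsum fun n => mul_le_mul' le_rfl (completeSum_mono h n hbc)

lemma one_le_genSum (t : ℝ≥0∞) (v : ℕ → ℝ≥0∞) (b : ℕ) : 1 ≤ genSum t v b := by
  refine le_trans ?_ (ENNReal.le_tsum 0)
  simp [completeSum]

lemma invSqLe_le (m : ℕ) : invSqLe m ≤ invSq := fun l => by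
  unfold invSqLe; split_ifs <;> simp

lemma completeSum_invSq_one_le {b : ℕ} (hb : 1 ≤ b) :
    completeSum invSq 1 b ≤ ENNReal.ofReal (2 / b) := by
  obtain ⟨c, rfl⟩ := Nat.exists_eq_add_of_le' hb
  have h1 : completeSum invSq 1 (c + 1) = ∑' i : ℕ, invSq (c + 1 + i) := by
    rw [← tsum_lt_succ]
    simp only [completeSum, mul_one]
    rfl
  -- The majorant is `1/l² ≤ 2/(l(l+1)) = 2/l - 2/(l+1)`.
  have h2 := tsum_telescope (F := fun i : ℕ => 2 / (((c : ℝ) + 1 + i) * (c + 1 + i + 1)))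
    (u := fun i : ℕ => 2 / ((c : ℝ) + 1 + i)) (l := 0) (fun i => by positivity)
    (fun i => by push_cast; field_simp; ring)
    (by
      refine tendsto_const_nhds.div_atTop ?_
      exact tendsto_atTop_add_const_left _ _ tendsto_natCast_atTop_atTop)
  rw [h1]
  refine (ENNReal.tsum_le_tsum fun i => ?_).trans (h2.le.trans ?_)
  · refine ENNReal.ofReal_le_ofReal ?_
    push_cast
    rw [inv_eq_one_div, div_le_div_iff₀ (by positivity) (by positivity)]
    nlinarith [show (0 : ℝ) ≤ c by positivity, show (0 : ℝ) ≤ i by positivity]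
  · simp

/-- Comparison with the geometric series of ratio `2t/b`; this is where `t < 1/2` comes from. -/
lemma genSum_invSq_le {t : ℝ} (ht : 0 < t) (ht2 : t < 1 / 2) {b : ℕ} (hb : 1 ≤ b) :
    genSum (ENNReal.ofReal t) invSq b ≤ ENNReal.ofReal (1 - 2 * t / b)⁻¹ := by
  have hb' : (1 : ℝ) ≤ b := by exact_mod_cast hb
  have hr : 2 * t / b < 1 := by
    rw [div_lt_one (by linarith)]; linarith
  rw [← tsum_geometric_of_lt_one (by positivity) hr, ENNReal.ofReal_tsum_of_nonneg
    (fun n => by positivity) (summable_geometric_of_lt_one (by positivity) hr)]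
  refine ENNReal.tsum_le_tsum fun n => ?_
  rw [ENNReal.ofReal_pow (by positivity), show 2 * t / b = t * (2 / b) by ring,
    ENNReal.ofReal_mul ht.le, mul_pow]
  gcongr
  exact (completeSum_le_pow _ _ _).trans (by gcongr; exact completeSum_invSq_one_le hb)

lemma genSum_invSq_ne_top {t : ℝ} (ht : 0 < t) (ht2 : t < 1 / 2) {b : ℕ} (hb : 1 ≤ b) :
    genSum (ENNReal.ofReal t) invSq b ≠ ⊤ :=
  ((genSum_invSq_le ht ht2 hb).trans_lt ENNReal.ofReal_lt_top).ne

lemma genSum_invSqLe_ne_top {t : ℝ} (ht : 0 < t) (ht2 : t < 1 / 2) (m : ℕ) {b : ℕ} (hb : 1 ≤ b) :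
    genSum (ENNReal.ofReal t) (invSqLe m) b ≠ ⊤ :=
  ((genSum_mono _ (invSqLe_le m) le_rfl).trans_lt (genSum_invSq_ne_top ht ht2 hb).lt_top).ne

/-- The real number `∏_{l ≥ b} (1 - t/l²)⁻¹`. -/
def tailProd (t : ℝ) (b : ℕ) : ℝ := (genSum (ENNReal.ofReal t) invSq b).toReal

/-- The product `∏_{1 ≤ l < b} (1 - t/l²)`. -/
def headProd (t : ℝ) (b : ℕ) : ℝ := ∏ l ∈ Finset.Ico 1 b, (1 - t / (l : ℝ) ^ 2)

lemma one_sub_div_sq_pos {t : ℝ} (ht : 0 < t) (ht2 : t < 1 / 2) {l : ℕ} (hl : 1 ≤ l) :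
    0 < 1 - t / (l : ℝ) ^ 2 := by
  have : (1 : ℝ) ≤ l := by exact_mod_cast hl
  rw [sub_pos, div_lt_one (by positivity)]
  nlinarith

lemma headProd_pos {t : ℝ} (ht : 0 < t) (ht2 : t < 1 / 2) (b : ℕ) : 0 < headProd t b :=
  Finset.prod_pos fun _ hl => one_sub_div_sq_pos ht ht2 (Finset.mem_Ico.1 hl).1

lemma headProd_one (t : ℝ) : headProd t 1 = 1 := by simp [headProd]

lemma headProd_succ (t : ℝ) {b : ℕ} (hb : 1 ≤ b) :
    headProd t (b + 1) = headProd t b * (1 - t / (b : ℝ) ^ 2) :=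
  Finset.prod_Ico_succ_top hb _

lemma toReal_genSum_succ {t : ℝ} (ht : 0 < t) {v : ℕ → ℝ≥0∞} {b : ℕ}
    (hv : v b = invSq b) (h0 : genSum (ENNReal.ofReal t) v b ≠ ⊤) :
    (genSum (ENNReal.ofReal t) v (b + 1)).toReal =
      (genSum (ENNReal.ofReal t) v b).toReal * (1 - t / (b : ℝ) ^ 2) := by
  have h1 : genSum (ENNReal.ofReal t) v (b + 1) ≠ ⊤ :=
    ((genSum_mono _ le_rfl (Nat.le_succ b)).trans_lt h0.lt_top).ne
  have h := congrArg ENNReal.toReal (genSum_succ (ENNReal.ofReal t) v b)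
  rw [hv, ENNReal.toReal_add (by finiteness [show invSq b ≠ ⊤ from ENNReal.ofReal_ne_top]) h1,
    ENNReal.toReal_mul, ENNReal.toReal_mul,
    ENNReal.toReal_ofReal ht.le, invSq, ENNReal.toReal_ofReal (by positivity)] at h
  rw [div_eq_mul_inv]
  linarith

lemma tailProd_succ {t : ℝ} (ht : 0 < t) (ht2 : t < 1 / 2) {b : ℕ} (hb : 1 ≤ b) :
    tailProd t (b + 1) = tailProd t b * (1 - t / (b : ℝ) ^ 2) :=
  toReal_genSum_succ ht rfl (genSum_invSq_ne_top ht ht2 hb)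

lemma ofReal_tailProd {t : ℝ} (ht : 0 < t) (ht2 : t < 1 / 2) {b : ℕ} (hb : 1 ≤ b) :
    ENNReal.ofReal (tailProd t b) = genSum (ENNReal.ofReal t) invSq b :=
  ENNReal.ofReal_toReal (genSum_invSq_ne_top ht ht2 hb)

/-- Both sides gain the factor `1 - t/b²` at each step. This turns the weight of `L` into that of
`B` up to a constant. -/
lemma tailProd_eq {t : ℝ} (ht : 0 < t) (ht2 : t < 1 / 2) {b : ℕ} (hb : 1 ≤ b) :
    tailProd t b = tailProd t 1 * headProd t b := by
  induction b, hb using Nat.le_induction with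
  | base => simp [headProd_one]
  | succ b hb ih => rw [tailProd_succ ht ht2 hb, ih, headProd_succ t hb, mul_assoc]

lemma tailProd_nonneg (t : ℝ) (b : ℕ) : 0 ≤ tailProd t b := ENNReal.toReal_nonneg

lemma tailProd_le {t : ℝ} (ht : 0 < t) (ht2 : t < 1 / 2) {b : ℕ} (hb : 1 ≤ b) :
    tailProd t b ≤ tailProd t 1 :=
  ENNReal.toReal_mono (genSum_invSq_ne_top ht ht2 le_rfl) (genSum_mono _ le_rfl hb)

lemma tendsto_tailProd {t : ℝ} (ht : 0 < t) (ht2 : t < 1 / 2) :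
    Tendsto (tailProd t) atTop (𝓝 1) := by
  have h : Tendsto (fun b : ℕ => (1 - 2 * t / (b : ℝ))⁻¹) atTop (𝓝 1) := by
    have h1 : Tendsto (fun b : ℕ => 1 - 2 * t / (b : ℝ)) atTop (𝓝 (1 - 0)) :=
      tendsto_const_nhds.sub (tendsto_const_div_atTop_nhds_zero_nat _)
    simpa using h1.inv₀ (by norm_num)
  refine tendsto_of_tendsto_of_tendsto_of_le_of_le' tendsto_const_nhds h ?_ ?_
  · filter_upwards [eventually_ge_atTop 1] with b hb
    have := ENNReal.toReal_mono (genSum_invSq_ne_top ht ht2 hb) (one_le_genSum _ _ _)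
    rwa [ENNReal.toReal_one] at this
  · filter_upwards [eventually_ge_atTop 1] with b hb
    refine ENNReal.toReal_le_of_le_ofReal ?_ (genSum_invSq_le ht ht2 hb)
    have hb' : (1 : ℝ) ≤ b := by exact_mod_cast hb
    rw [inv_nonneg, sub_nonneg, div_le_one (by linarith)]
    linarith

lemma completeSum_invSqLe_of_lt {m b : ℕ} (h : m < b) (n : ℕ) :
    completeSum (invSqLe m) (n + 1) b = 0 := by
  refine ENNReal.tsum_eq_zero.2 fun l => ?_
  split_ifs with hl
  · simp [invSqLe, show ¬ l ≤ m by omega]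
  · rfl

/-- Both sides obey the same recursion in `b`; the constant is fixed at `b = m + 1`, where the
product is empty. -/
lemma genSum_invSqLe {t : ℝ} (ht : 0 < t) (ht2 : t < 1 / 2) {m b : ℕ} (hb : 1 ≤ b)
    (hbm : b ≤ m + 1) :
    genSum (ENNReal.ofReal t) (invSqLe m) b =
      ENNReal.ofReal (headProd t b / headProd t (m + 1)) := by
  have key : ∀ b, 1 ≤ b → b ≤ m + 1 → (genSum (ENNReal.ofReal t) (invSqLe m) b).toReal =
      (genSum (ENNReal.ofReal t) (invSqLe m) 1).toReal * headProd t b := by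
    intro b hb
    induction b, hb using Nat.le_induction with
    | base => simp [headProd_one]
    | succ b hb ih =>
      intro h
      rw [toReal_genSum_succ ht (by simp [invSqLe, show b ≤ m by omega])
        (genSum_invSqLe_ne_top ht ht2 m hb), ih (by omega), headProd_succ t hb, mul_assoc]
  have hlast : genSum (ENNReal.ofReal t) (invSqLe m) (m + 1) = 1 := by
    rw [genSum, tsum_eq_zero_add' ENNReal.summable]
    simp [completeSum_invSqLe_of_lt (Nat.lt_succ_self m)]
    simp [completeSum]
  have h1 := key (m + 1) (by omega) le_rfl
  rw [hlast, ENNReal.toReal_one] at h1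
  have hp := headProd_pos ht ht2 (m + 1)
  rw [← ENNReal.ofReal_toReal (genSum_invSqLe_ne_top ht ht2 m hb), key b hb hbm]
  congr 1
  rw [eq_div_iff hp.ne', mul_right_comm, ← h1, one_mul]

/-! ### The connector -/

/-- The connector `m! n! / (m + n)!`. -/
def conn (m n : ℕ) : ℝ := (m.factorial * n.factorial : ℝ) / (m + n).factorial

lemma conn_comm (m n : ℕ) : conn m n = conn n m := by
  rw [conn, conn, mul_comm, add_comm]

lemma conn_pos (m n : ℕ) : 0 < conn m n := by unfold conn; positivity

lemma conn_zero_left (n : ℕ) : conn 0 n = 1 := by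
  simp [conn, Nat.factorial_ne_zero]

lemma conn_succ_left (m n : ℕ) : conn (m + 1) n * (m + 1 + n) = conn m n * (m + 1) := by
  have h : (m + 1 + n).factorial = (m + n + 1) * (m + n).factorial := by
    rw [show m + 1 + n = m + n + 1 by ring, Nat.factorial_succ]
  rw [conn, conn, h, Nat.factorial_succ]
  push_cast
  field_simp
  ring

lemma conn_succ_right (m n : ℕ) : conn m (n + 1) * (m + n + 1) = conn m n * (n + 1) := by
  rw [conn_comm m, conn_comm m, ← conn_succ_left]; ring

/-- `conn m n` decreases in `n`, and `conn m 1 = 1/(m+1)`. -/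
lemma conn_le {m n : ℕ} (hn : 1 ≤ n) : conn m n ≤ 1 / (m + 1) := by
  induction n, hn using Nat.le_induction with
  | base =>
    have := conn_succ_right m 0
    rw [conn_comm m 0, conn_zero_left] at this
    rw [le_div_iff₀ (by positivity)]
    push_cast at this
    simp only [zero_add] at this
    linarith
  | succ n hn ih =>
    refine le_trans ?_ ih
    have := conn_succ_right m n
    have h0 := conn_pos m n
    have h1 := conn_pos m (n + 1)
    have hm : (0 : ℝ) ≤ m := by positivity
    have hn : (0 : ℝ) ≤ n := by positivity
    nlinarith [mul_nonneg h1.le hm]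

lemma tendsto_conn {n : ℕ} (hn : 1 ≤ n) : Tendsto (fun m => conn m n) atTop (𝓝 0) :=
  squeeze_zero (fun m => (conn_pos m n).le) (fun _ => conn_le hn)
    tendsto_one_div_add_atTop_nhds_zero_nat

/-- The transport relation of the connector. -/
lemma tsum_conn (m : ℕ) {n : ℕ} (hn : 1 ≤ n) :
    (∑' k : ℕ, if m < k then ENNReal.ofReal (k : ℝ)⁻¹ * ENNReal.ofReal (conn k n) else 0) =
      ENNReal.ofReal (n : ℝ)⁻¹ * ENNReal.ofReal (conn m n) := by
  have hn' : (0 : ℝ) < n := by exact_mod_cast hn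
  rw [tsum_lt_succ (fun k : ℕ => ENNReal.ofReal (k : ℝ)⁻¹ * ENNReal.ofReal (conn k n))]
  simp only [← ENNReal.ofReal_mul' (conn_pos _ _).le]
  -- By `conn_succ_left`, `conn k n / k = (conn (k-1) n - conn k n) / n`.
  rw [tsum_telescope (u := fun i => (n : ℝ)⁻¹ * conn (m + i) n) (l := 0)]
  · simp
  · exact fun i => mul_nonneg (by positivity) (conn_pos _ _).le
  · intro i
    have h := conn_succ_left (m + i) n
    rw [show m + 1 + i = m + i + 1 by ring, show m + (i + 1) = m + i + 1 by ring]
    push_cast at h ⊢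
    field_simp
    linarith
  · simpa using ((tendsto_conn hn).comp (tendsto_add_atTop_nat m)).const_mul ((n : ℝ)⁻¹) |>.congr
      (fun i => by simp [add_comm])

/-! ### The connector summed against the tail products -/

/-- The telescoping relation behind Gauss' summation theorem. -/
lemma conn_tailProd_telescope {t : ℝ} (ht : 0 < t) (ht2 : t < 1 / 2) (m b : ℕ) :
    ((m : ℝ) + 1 - t / (m + 1)) * (tailProd t (b + 1) * ((b + 1 : ℝ)⁻¹ * conn (m + 1) (b + 1))) -
      m * (tailProd t (b + 1) * ((b + 1 : ℝ)⁻¹ * conn m (b + 1))) =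
    ((b + 1 : ℝ) / (b + 2)) * conn m (b + 2) * tailProd t (b + 2) -
      (b / (b + 1 : ℝ)) * conn m (b + 1) * tailProd t (b + 1) := by
  have h1 := conn_succ_left m (b + 1)
  have h2 := conn_succ_right m (b + 1)
  have h3 := tailProd_succ ht ht2 (b := b + 1) (by omega)
  rw [show b + 1 + 1 = b + 2 by ring] at h2 h3
  push_cast at h1 h2 h3
  have e1 : conn (m + 1) (b + 1) = conn m (b + 1) * (m + 1) / (m + 1 + (b + 1)) := by
    rw [eq_div_iff (by positivity)]; exact h1
  have e2 : conn m (b + 2) = conn m (b + 1) * (b + 1 + 1) / (m + (b + 1) + 1) := by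
    rw [eq_div_iff (by positivity)]; exact h2
  rw [e1, e2, h3]
  field_simp
  ring

/-- The boundary term of the telescoping. It survives only for `m = 0`, where the connector is
constantly `1`, and there it starts the recursion in `m`. -/
lemma tendsto_conn_tailProd {t : ℝ} (ht : 0 < t) (ht2 : t < 1 / 2) (m : ℕ) :
    Tendsto (fun b : ℕ => (b / (b + 1 : ℝ)) * conn m (b + 1) * tailProd t (b + 1)) atTop
      (𝓝 (if m = 0 then 1 else 0)) := by
  have h1 : Tendsto (fun b : ℕ => (b / (b + 1 : ℝ))) atTop (𝓝 1) :=
    tendsto_natCast_div_add_atTop (1 : ℝ)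
  have h2 : Tendsto (fun b : ℕ => conn m (b + 1)) atTop (𝓝 (if m = 0 then 1 else 0)) := by
    split_ifs with hm
    · subst hm
      simp [conn_zero_left]
    · simp only [conn_comm m]
      exact (tendsto_conn (Nat.one_le_iff_ne_zero.2 hm)).comp (tendsto_add_atTop_nat 1)
  simpa using (h1.mul h2).mul ((tendsto_tailProd ht ht2).comp (tendsto_add_atTop_nat 1))

lemma summable_conn_tailProd {t : ℝ} (ht : 0 < t) (ht2 : t < 1 / 2) {m : ℕ} (hm : 1 ≤ m) :
    Summable fun b : ℕ => tailProd t (b + 1) * ((b + 1 : ℝ)⁻¹ * conn m (b + 1)) := by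
  have h : Summable fun b : ℕ => tailProd t 1 * (1 / ((b + 1 : ℕ) : ℝ) ^ 2) :=
    ((summable_nat_add_iff 1).2 (Real.summable_one_div_nat_pow.2 one_lt_two)).mul_left _
  refine Summable.of_nonneg_of_le (fun b => ?_) (fun b => ?_) h
  · exact mul_nonneg (tailProd_nonneg _ _) (mul_nonneg (by positivity) (conn_pos _ _).le)
  · refine mul_le_mul (tailProd_le ht ht2 (by omega)) ?_
      (mul_nonneg (by positivity) (conn_pos _ _).le) (tailProd_nonneg _ _)
    have h1 : conn m (b + 1) ≤ (b + 1 : ℝ)⁻¹ := by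
      rw [conn_comm]
      refine (conn_le hm).trans ?_
      rw [← one_div]
      push_cast
      gcongr
      linarith
    push_cast
    rw [one_div, sq, mul_inv]
    gcongr

/-- Writing `S m` for the sum, telescoping gives `(m+1)(1 - t/(m+1)²) S m = m S (m-1)` for `m ≥ 1`
and `(1 - t) S 0 = 1`, which the product formula solves. -/
lemma hasSum_conn_tailProd {t : ℝ} (ht : 0 < t) (ht2 : t < 1 / 2) (m : ℕ) :
    HasSum (fun b : ℕ => tailProd t (b + 1) * ((b + 1 : ℝ)⁻¹ * conn (m + 1) (b + 1)))
      ((m + 1 : ℝ)⁻¹ * (headProd t (m + 2))⁻¹) := by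
  have hS (m : ℕ) := (summable_conn_tailProd ht ht2 (m := m + 1) (by omega)).hasSum
  set S : ℕ → ℝ := fun m =>
    ∑' b : ℕ, tailProd t (b + 1) * ((b + 1 : ℝ)⁻¹ * conn (m + 1) (b + 1)) with hSdef
  -- The factor `m` stays inside the series: at `m = 0` it kills a divergent sum.
  have tel (m : ℕ) (T : ℝ)
      (hT : HasSum (fun b : ℕ => (m : ℝ) *
        (tailProd t (b + 1) * ((b + 1 : ℝ)⁻¹ * conn m (b + 1)))) T) :
      ((m : ℝ) + 1 - t / (m + 1)) * S m - T = if m = 0 then 1 else 0 := by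
    have h := (((hS m).mul_left ((m : ℝ) + 1 - t / (m + 1))).sub hT).tendsto_sum_nat
    refine tendsto_nhds_unique h ?_
    simp only [conn_tailProd_telescope ht ht2]
    refine (tendsto_conn_tailProd ht ht2 m).congr fun N => ?_
    have := Finset.sum_range_sub
      (fun b : ℕ => (b / (b + 1 : ℝ)) * conn m (b + 1) * tailProd t (b + 1)) N
    simp only [CharP.cast_eq_zero, zero_div, zero_mul, sub_zero] at this
    rw [← this]
    refine Finset.sum_congr rfl fun b _ => ?_
    push_cast
    ring_nf
  have hval : ∀ m : ℕ, S m = (m + 1 : ℝ)⁻¹ * (headProd t (m + 2))⁻¹ := by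
    intro m
    induction m using Nat.strong_induction_on with | _ m ih =>
    have hh := headProd_succ t (b := m + 1) (by omega)
    have hq := one_sub_div_sq_pos ht ht2 (l := m + 1) (by omega)
    rw [show m + 1 + 1 = m + 2 by ring] at hh
    push_cast at hh hq
    have hfac : (m : ℝ) + 1 - t / (m + 1) = (m + 1) * (1 - t / (m + 1) ^ 2) := by
      field_simp
    have hmain : (m + 1) * (1 - t / (m + 1 : ℝ) ^ 2) * S m = (headProd t (m + 1))⁻¹ := by
      rw [← hfac]
      cases m with
      | zero =>
        have := tel 0 0 (by simp)
        rw [headProd_one]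
        simpa using this
      | succ m =>
        have h := tel (m + 1) (((m + 1 : ℕ) : ℝ) * S m) (by
          simpa using (hS m).mul_left ((m : ℝ) + 1))
        rw [if_neg m.succ_ne_zero, sub_eq_zero, ih m (Nat.lt_succ_self m)] at h
        rw [h]
        push_cast
        field_simp
    rw [hh, mul_inv, ← hmain]
    generalize 1 - t / (m + 1 : ℝ) ^ 2 = q at hq
    field_simp
  rw [← hval]
  exact hS m

lemma tsum_conn_tailProd {t : ℝ} (ht : 0 < t) (ht2 : t < 1 / 2) {m : ℕ} (hm : 1 ≤ m) :
    (∑' b : ℕ, if 0 < b then ENNReal.ofReal (tailProd t b) *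
      (ENNReal.ofReal (b : ℝ)⁻¹ * ENNReal.ofReal (conn m b)) else 0) =
      ENNReal.ofReal (m : ℝ)⁻¹ * ENNReal.ofReal (headProd t (m + 1))⁻¹ := by
  obtain ⟨m, rfl⟩ := Nat.exists_eq_add_of_le' hm
  have h := hasSum_conn_tailProd ht ht2 m
  have h0 : ∀ b : ℕ, 0 ≤ tailProd t (b + 1) * ((b + 1 : ℝ)⁻¹ * conn (m + 1) (b + 1)) := fun b =>
    mul_nonneg (tailProd_nonneg _ _) (mul_nonneg (by positivity) (conn_pos _ _).le)
  rw [tsum_lt_succ (fun b => ENNReal.ofReal (tailProd t b) *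
      (ENNReal.ofReal (b : ℝ)⁻¹ * ENNReal.ofReal (conn (m + 1) b))),
    ← ENNReal.ofReal_mul (by positivity)]
  push_cast
  rw [← h.tsum_eq, ENNReal.ofReal_tsum_of_nonneg h0 h.summable]
  refine tsum_congr fun b => ?_
  rw [ENNReal.ofReal_mul (tailProd_nonneg _ _), ENNReal.ofReal_mul (by positivity)]
  simp [add_comm]

/-! ### Operators attached to words -/

/-- `k⁻¹` as an extended nonnegative real. -/
def recip (k : ℕ) : ℝ≥0∞ := ENNReal.ofReal (k : ℝ)⁻¹

/-- The operator of a letter: `true` acts by `ρ ↦ (b ↦ ∑_{k > b} ρ(k)/k)` and `false` by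
`ρ ↦ (k ↦ ρ(k)/k)`. -/
def letterOp (c : Bool) (ρ : ℕ → ℝ≥0∞) (b : ℕ) : ℝ≥0∞ :=
  if c then ∑' k : ℕ, (if b < k then recip k else 0) * ρ k else recip b * ρ b

/-- The operator of a word, the first letter being applied last. -/
def wordOp (w : List Bool) (ρ : ℕ → ℝ≥0∞) : ℕ → ℝ≥0∞ := w.foldr letterOp ρ

/-- The functional `ρ ↦ ∑_{k > 0} φ(k) ρ(k)/k`. -/
def pairing (φ ρ : ℕ → ℝ≥0∞) : ℝ≥0∞ := ∑' k : ℕ, (if 0 < k then φ k * recip k else 0) * ρ k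

/-- Reversal of a word with exchange of the letters. -/
def dualWord (w : List Bool) : List Bool := (w.map not).reverse

/-- The connector as an extended nonnegative real. -/
def econn (m n : ℕ) : ℝ≥0∞ := ENNReal.ofReal (conn m n)

lemma econn_comm (m n : ℕ) : econn m n = econn n m := by rw [econn, conn_comm, econn]

@[simp] lemma wordOp_nil (ρ : ℕ → ℝ≥0∞) : wordOp [] ρ = ρ := rfl

@[simp] lemma wordOp_cons (c : Bool) (w : List Bool) (ρ : ℕ → ℝ≥0∞) :
    wordOp (c :: w) ρ = letterOp c (wordOp w ρ) := rfl

lemma wordOp_append (u w : List Bool) (ρ : ℕ → ℝ≥0∞) :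
    wordOp (u ++ w) ρ = wordOp u (wordOp w ρ) := List.foldr_append

lemma letterOp_le (c : Bool) {ρ σ : ℕ → ℝ≥0∞} (h : ∀ k, 0 < k → ρ k ≤ σ k) {b : ℕ} (hb : 0 < b) :
    letterOp c ρ b ≤ letterOp c σ b := by
  cases c
  · simpa [letterOp] using mul_le_mul' le_rfl (h b hb)
  · simp only [letterOp, if_true]
    refine ENNReal.tsum_le_tsum fun k => ?_
    split_ifs with hk
    · exact mul_le_mul' le_rfl (h k (by omega))
    · simp

lemma wordOp_le (w : List Bool) {ρ σ : ℕ → ℝ≥0∞} (h : ∀ k, 0 < k → ρ k ≤ σ k) {b : ℕ}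
    (hb : 0 < b) : wordOp w ρ b ≤ wordOp w σ b := by
  induction w generalizing b with
  | nil => exact h b hb
  | cons c w ih => exact letterOp_le c (fun k hk => ih hk) hb

lemma letterOp_congr (c : Bool) {ρ σ : ℕ → ℝ≥0∞} (h : ∀ k, 0 < k → ρ k = σ k) {b : ℕ}
    (hb : 0 < b) : letterOp c ρ b = letterOp c σ b :=
  (letterOp_le c (fun k hk => (h k hk).le) hb).antisymm
    (letterOp_le c (fun k hk => (h k hk).ge) hb)

lemma wordOp_congr (w : List Bool) {ρ σ : ℕ → ℝ≥0∞} (h : ∀ k, 0 < k → ρ k = σ k) {b : ℕ}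
    (hb : 0 < b) : wordOp w ρ b = wordOp w σ b :=
  (wordOp_le w (fun k hk => (h k hk).le) hb).antisymm
    (wordOp_le w (fun k hk => (h k hk).ge) hb)

lemma pairing_le (φ : ℕ → ℝ≥0∞) {ρ σ : ℕ → ℝ≥0∞} (h : ∀ k, 0 < k → ρ k ≤ σ k) :
    pairing φ ρ ≤ pairing φ σ := by
  refine ENNReal.tsum_le_tsum fun k => ?_
  split_ifs with hk
  · exact mul_le_mul' le_rfl (h k hk)
  · simp

lemma pairing_congr (φ : ℕ → ℝ≥0∞) {ρ σ : ℕ → ℝ≥0∞} (h : ∀ k, 0 < k → ρ k = σ k) :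
    pairing φ ρ = pairing φ σ :=
  (pairing_le φ fun k hk => (h k hk).le).antisymm (pairing_le φ fun k hk => (h k hk).ge)

lemma letterOp_tsum (c : Bool) (a : ℕ → ℝ≥0∞) (K : ℕ → ℕ → ℝ≥0∞) :
    letterOp c (fun m => ∑' i, a i * K i m) = fun m => ∑' i, a i * letterOp c (K i) m := by
  ext m
  cases c
  · simp only [letterOp, Bool.false_eq_true, if_false, ← ENNReal.tsum_mul_left]
    exact tsum_congr fun i => by ring
  · simp only [letterOp, if_true, ← ENNReal.tsum_mul_left]
    rw [ENNReal.tsum_comm]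
    exact tsum_congr fun i => tsum_congr fun k => by ring

lemma wordOp_tsum (w : List Bool) (a : ℕ → ℝ≥0∞) (K : ℕ → ℕ → ℝ≥0∞) :
    wordOp w (fun m => ∑' i, a i * K i m) = fun m => ∑' i, a i * wordOp w (K i) m := by
  induction w with
  | nil => rfl
  | cons c w ih => simp only [wordOp_cons, ih, letterOp_tsum]

lemma wordOp_const_mul (w : List Bool) (a : ℝ≥0∞) (ρ : ℕ → ℝ≥0∞) :
    wordOp w (fun m => a * ρ m) = fun m => a * wordOp w ρ m := by
  have h := wordOp_tsum w (fun i => if i = 0 then a else 0) (fun _ => ρ)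
  simpa [ite_mul, tsum_ite_eq] using h

lemma pairing_const_mul (φ : ℕ → ℝ≥0∞) (a : ℝ≥0∞) (ρ : ℕ → ℝ≥0∞) :
    pairing φ (fun m => a * ρ m) = a * pairing φ ρ := by
  rw [pairing, pairing, ← ENNReal.tsum_mul_left]
  exact tsum_congr fun k => by ring

/-- Operators acting on different variables of a kernel commute. -/
lemma letterOp_wordOp_comm (c : Bool) (w : List Bool) (K : ℕ → ℕ → ℝ≥0∞) (m n : ℕ) :
    letterOp c (fun m => wordOp w (K m) n) m = wordOp w (fun n => letterOp c (fun m => K m n) m) n := by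
  cases c
  · simp only [letterOp, Bool.false_eq_true, if_false, wordOp_const_mul]
  · simp only [letterOp, if_true, wordOp_tsum]

lemma letterOp_true_econn (m : ℕ) {n : ℕ} (hn : 0 < n) :
    letterOp true (fun m => econn m n) m = recip n * econn m n := by
  simp only [letterOp, if_true, ite_mul, zero_mul]
  exact tsum_conn m hn

/-- For `true` this is the transport relation; for `false` it is the same relation with `m` and `n`
swapped. -/
lemma letterOp_econn (c : Bool) {m n : ℕ} (hm : 0 < m) (hn : 0 < n) :
    letterOp c (fun m => econn m n) m = letterOp (!c) (econn m) n := by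
  cases c
  · have h := letterOp_true_econn n hm
    rw [econn_comm] at h
    simp only [econn_comm _ m] at h
    rw [Bool.not_false, h]
    simp [letterOp]
  · rw [letterOp_true_econn m hn]
    simp [letterOp]

/-- The tail `w` crosses first. The letter `c`, still in `m`, commutes past it and crosses next to
the connector, so it lands last: hence the reversal. -/
lemma wordOp_econn (w : List Bool) {m n : ℕ} (hm : 0 < m) (hn : 0 < n) :
    wordOp w (fun m => econn m n) m = wordOp (dualWord w) (econn m) n := by
  induction w generalizing m n with
  | nil => rfl
  | cons c w ih =>
    have hd : dualWord (c :: w) = dualWord w ++ [!c] := by simp [dualWord]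
    rw [wordOp_cons, letterOp_congr c (fun k hk => ih hk hn) hm, letterOp_wordOp_comm, hd,
      wordOp_append, wordOp_cons, wordOp_nil]
    exact wordOp_congr _ (fun k hk => letterOp_econn c hm hk) hn

/-- Duality for connected sums with weights on the smallest indices. -/
lemma pairing_wordOp_duality (φ ψ : ℕ → ℝ≥0∞) (w : List Bool) :
    pairing φ (wordOp w fun m => pairing ψ (econn m)) =
      pairing ψ (wordOp (dualWord w) fun n => pairing φ fun m => econn m n) := by
  have h1 : ∀ m, 0 < m → wordOp w (fun m => pairing ψ (econn m)) m =
      pairing ψ (wordOp (dualWord w) (econn m)) := fun m hm => by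
    have := congrFun (wordOp_tsum w (fun i => if 0 < i then ψ i * recip i else 0)
      (fun n m => econn m n)) m
    exact this.trans (pairing_congr ψ fun n hn => wordOp_econn w hm hn)
  have h2 : (wordOp (dualWord w) fun n => pairing φ fun m => econn m n) =
      fun n => pairing φ fun m => wordOp (dualWord w) (econn m) n :=
    wordOp_tsum _ _ _
  rw [pairing_congr φ h1, h2]
  simp only [pairing, ← ENNReal.tsum_mul_left]
  rw [ENNReal.tsum_comm]
  exact tsum_congr fun n => tsum_congr fun m => by ring

/-- The case `m = 0` of the transport relation, as `conn 0 n = 1`. -/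
lemma pairing_one_econn {n : ℕ} (hn : 0 < n) : pairing 1 (fun m => econn m n) = recip n := by
  have h := letterOp_true_econn 0 hn
  simpa [letterOp, pairing, econn, conn_zero_left] using h

/-! ### Words of indices -/

/-- The word of an index, each entry `a` giving a letter `true` and `a - 1` letters `false`. -/
def indexWord (α : List ℕ) : List Bool := α.flatMap fun a => true :: List.replicate (a - 1) false

lemma wordOp_replicate_false (j : ℕ) (ρ : ℕ → ℝ≥0∞) (k : ℕ) :
    wordOp (List.replicate j false) ρ k = recip k ^ j * ρ k := by
  induction j with
  | zero => simp
  | succ j ih =>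
    rw [List.replicate_succ, wordOp_cons]
    simp only [letterOp, Bool.false_eq_true, if_false, ih]
    ring

lemma ofReal_inv_pow {a : ℕ} (ha : 1 ≤ a) (k : ℕ) :
    ENNReal.ofReal ((k : ℝ) ^ a)⁻¹ = recip k * recip k ^ (a - 1) := by
  rw [← pow_succ', Nat.sub_add_cancel ha, recip, ← ENNReal.ofReal_pow (by positivity), inv_pow]

lemma nestedSum_eq_wordOp (ρ : ℕ → ℝ≥0∞) {α : List ℕ} (hα : ∀ a ∈ α, 1 ≤ a) (b : ℕ) :
    nestedSum ρ α b = wordOp (indexWord α) ρ b := by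
  induction α generalizing b with
  | nil => rfl
  | cons a α ih =>
    rw [nestedSum, indexWord, List.flatMap_cons, List.cons_append, wordOp_cons, wordOp_append]
    simp only [letterOp, if_true]
    refine tsum_congr fun k => ?_
    split_ifs
    · rw [wordOp_replicate_false, ofReal_inv_pow (hα a (by simp)),
        ih (fun x hx => hα x (List.mem_cons_of_mem _ hx)), mul_assoc]
      rfl
    · simp

/-- The initial `true` is the sum in `pairing`, the final `false` the factor `recip m`; only the
middle word `w` has to cross the connector. -/
lemma tsum_strictTuples_eq_pairing (φ ρ : ℕ → ℝ≥0∞) {a : ℕ} {α : List ℕ} {w : List Bool}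
    (hα : ∀ x ∈ a :: α, 1 ≤ x) (hw : indexWord (a :: α) = true :: (w ++ [false])) :
    ∑' k : StrictTuples (a :: α).length, ENNReal.ofReal (term (a :: α) k.1) *
      (φ (k.1 (0 : Fin (α.length + 1))) * ρ (k.1 (Fin.last α.length))) =
    pairing φ (wordOp w fun m => recip m * ρ m) := by
  have hw' : List.replicate (a - 1) false ++ indexWord α = w ++ [false] := by
    have : true :: (List.replicate (a - 1) false ++ indexWord α) = true :: (w ++ [false]) := hw
    exact (List.cons.inj this).2
  have hop : (wordOp w fun m => recip m * ρ m) =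
      wordOp (List.replicate (a - 1) false ++ indexWord α) ρ := by
    rw [hw', wordOp_append]
    rfl
  rw [tsum_strictTuples, hop, wordOp_append]
  refine tsum_congr fun k => ?_
  split_ifs
  · rw [wordOp_replicate_false, ofReal_inv_pow (hα a (by simp)),
      nestedSum_eq_wordOp ρ (fun x hx => hα x (List.mem_cons_of_mem _ hx))]
    ring
  · simp

lemma indexWord_append (α β : List ℕ) : indexWord (α ++ β) = indexWord α ++ indexWord β := by
  simp [indexWord]

lemma indexWord_block (a b : ℕ) : indexWord (List.replicate a 1 ++ [b + 2]) =
    List.replicate (a + 1) true ++ List.replicate (b + 1) false := by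
  have h : indexWord (List.replicate a 1) = List.replicate a true := by
    induction a with
    | zero => rfl
    | succ a ih =>
      rw [List.replicate_succ, List.replicate_succ, ← ih]
      rfl
  rw [indexWord_append, h, List.replicate_succ' (n := a)]
  simp [indexWord]

lemma dualWord_append (u w : List Bool) : dualWord (u ++ w) = dualWord w ++ dualWord u := by
  simp [dualWord]

/-- A pair `(a, b)` spells `true^(a+1) false^(b+1)`; reversing and exchanging letters spells `(b,
a)`. -/
lemma dualWord_indexWord (ps : List (ℕ × ℕ)) :
    dualWord (indexWord (ps.flatMap fun p => List.replicate p.1 1 ++ [p.2 + 2])) =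
      indexWord (ps.reverse.flatMap fun p => List.replicate p.2 1 ++ [p.1 + 2]) := by
  induction ps with
  | nil => rfl
  | cons p ps ih =>
    rw [List.flatMap_cons, indexWord_append (_ ++ _), dualWord_append, ih, List.reverse_cons,
      List.flatMap_append, indexWord_append (List.flatMap _ _), List.flatMap_singleton,
      indexWord_block, indexWord_block]
    simp [dualWord]

lemma exists_indexWord_eq {ps : List (ℕ × ℕ)} (hps : ps ≠ []) :
    ∃ w, indexWord (ps.flatMap fun p => List.replicate p.1 1 ++ [p.2 + 2]) =
      true :: (w ++ [false]) := by
  induction ps with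
  | nil => exact absurd rfl hps
  | cons p ps ih =>
    rw [List.flatMap_cons, indexWord_append, indexWord_block]
    by_cases h : ps = []
    · subst h
      refine ⟨List.replicate p.1 true ++ List.replicate p.2 false, ?_⟩
      rw [List.replicate_succ, List.replicate_succ' (n := p.2)]
      simp [indexWord]
    · obtain ⟨w, hw⟩ := ih h
      refine ⟨List.replicate p.1 true ++ List.replicate (p.2 + 1) false ++ true :: w, ?_⟩
      rw [hw, List.replicate_succ (n := p.1)]
      simp

lemma one_le_of_mem_flatMap {ps : List (ℕ × ℕ)} :
    ∀ x ∈ ps.flatMap (fun p => List.replicate p.1 1 ++ [p.2 + 2]), 1 ≤ x := by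
  intro x hx
  simp only [List.mem_flatMap, List.mem_append, List.mem_replicate, List.mem_singleton] at hx
  obtain ⟨p, -, h | h⟩ := hx <;> omega

/-- Dual indices are nonempty with positive entries, and have dual words. -/
lemma IsDual.exists_word {α β : List ℕ} (h : IsDual α β) :
    ∃ (a : ℕ) (α' : List ℕ) (b : ℕ) (β' : List ℕ) (w : List Bool),
      α = a :: α' ∧ β = b :: β' ∧ (∀ x ∈ α, 1 ≤ x) ∧ (∀ x ∈ β, 1 ≤ x) ∧
      indexWord α = true :: (w ++ [false]) ∧ indexWord β = true :: (dualWord w ++ [false]) := by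
  obtain ⟨ps, hps, rfl, rfl⟩ := h
  obtain ⟨w, hw⟩ := exists_indexWord_eq hps
  have hd := dualWord_indexWord ps
  rw [hw] at hd
  have hw' : indexWord (ps.reverse.flatMap fun p => List.replicate p.2 1 ++ [p.1 + 2]) =
      true :: (dualWord w ++ [false]) := by
    rw [← hd]; simp [dualWord]
  have hpos : ∀ x ∈ ps.reverse.flatMap (fun p => List.replicate p.2 1 ++ [p.1 + 2]), 1 ≤ x := by
    intro x hx
    simp only [List.mem_flatMap, List.mem_append, List.mem_replicate, List.mem_singleton] at hx
    obtain ⟨p, -, h | h⟩ := hx <;> omega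
  have ne {γ : List ℕ} {u : List Bool} (h : indexWord γ = true :: u) :
      ∃ c γ', γ = c :: γ' := by
    cases γ with
    | nil => exact absurd h (by simp [indexWord])
    | cons c γ' => exact ⟨c, γ', rfl⟩
  obtain ⟨a, α', hα⟩ := ne hw
  obtain ⟨b, β', hβ⟩ := ne hw'
  exact ⟨a, α', b, β', w, hα, hβ, one_le_of_mem_flatMap, hpos, hw, hw'⟩

/-! ### Finiteness -/

/-- `k^{-1/2}` as an extended nonnegative real. -/
def invSqrt (k : ℕ) : ℝ≥0∞ := ENNReal.ofReal (1 / √(k : ℝ))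

lemma recip_le_one (k : ℕ) : recip k ≤ 1 := by
  rw [recip]
  exact ENNReal.ofReal_le_one.2 (Nat.cast_inv_le_one k)

/-- Telescoping of `k^(-3/2) ≤ 2/√(k-1) - 2/√k`. So `k^(-1/2)` is preserved by both letters up to a
factor `2`. -/
lemma letterOp_true_invSqrt_le {b : ℕ} (hb : 0 < b) :
    letterOp true invSqrt b ≤ 2 * invSqrt b := by
  have hb' : (0 : ℝ) < b := by exact_mod_cast hb
  have h := tsum_lt_succ (fun k => recip k * invSqrt k) b
  simp only [letterOp, if_true, ite_mul, zero_mul, h]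
  have key : ∀ i : ℕ, 0 < √((b : ℝ) + i) ∧ √((b : ℝ) + i) ≤ √((b : ℝ) + i + 1) ∧
      √((b : ℝ) + i) ^ 2 = b + i ∧ √((b : ℝ) + i + 1) ^ 2 = b + i + 1 := fun i =>
    ⟨Real.sqrt_pos.2 (by positivity), Real.sqrt_le_sqrt (by linarith),
      Real.sq_sqrt (by positivity), Real.sq_sqrt (by positivity)⟩
  have hu : Tendsto (fun i : ℕ => 2 / √((b : ℝ) + i)) atTop (𝓝 0) := by
    refine tendsto_const_nhds.div_atTop ?_
    exact Real.tendsto_sqrt_atTop.comp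
      (tendsto_atTop_add_const_left _ _ tendsto_natCast_atTop_atTop)
  have ht := tsum_telescope (F := fun i : ℕ => 2 / √((b : ℝ) + i) - 2 / √((b : ℝ) + i + 1))
    (u := fun i : ℕ => 2 / √((b : ℝ) + i)) (l := 0)
    (fun i => by
      obtain ⟨h0, h1, -, -⟩ := key i
      rw [sub_nonneg]
      gcongr)
    (fun i => by push_cast; rw [add_assoc]) hu
  calc _ ≤ ∑' i : ℕ, ENNReal.ofReal (2 / √((b : ℝ) + i) - 2 / √((b : ℝ) + i + 1)) := by
        refine ENNReal.tsum_le_tsum fun i => ?_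
        rw [recip, invSqrt, ← ENNReal.ofReal_mul (by positivity)]
        refine ENNReal.ofReal_le_ofReal ?_
        obtain ⟨h0, h1, h2, h3⟩ := key i
        push_cast
        rw [show (b : ℝ) + 1 + i = b + i + 1 by ring]
        rw [← h3, Real.sqrt_sq (by positivity)]
        generalize √((b : ℝ) + i) = x at *
        generalize √((b : ℝ) + i + 1) = y at *
        have hy : 0 < y := by linarith
        rw [div_sub_div _ _ h0.ne' hy.ne', ← one_div, div_mul_div_comm,
          div_le_div_iff₀ (by positivity) (by positivity)]
        have e : (y - x) * (y + x) = 1 := by nlinarith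
        have e2 : 0 ≤ y - x := by linarith
        have e3 : x * (y + x) * (y - x) ≤ 2 * y ^ 2 * (y - x) := by
          refine mul_le_mul_of_nonneg_right ?_ e2
          nlinarith
        have e4 : x ≤ 2 * y ^ 2 * (y - x) := by
          rwa [mul_assoc, mul_comm (y + x), e, mul_one] at e3
        linarith [mul_le_mul_of_nonneg_right e4 hy.le]
    _ = 2 * invSqrt b := by
        rw [ht, invSqrt, ← ENNReal.ofReal_ofNat, ← ENNReal.ofReal_mul (by norm_num)]
        simp [div_eq_mul_inv]

lemma wordOp_invSqrt_le (w : List Bool) {b : ℕ} (hb : 0 < b) :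
    wordOp w invSqrt b ≤ 2 ^ w.length * invSqrt b := by
  induction w generalizing b with
  | nil => simp
  | cons c w ih =>
    rw [wordOp_cons]
    refine (letterOp_le c (fun k hk => ih hk) hb).trans ?_
    have h := congrFun (wordOp_const_mul [c] (2 ^ w.length) invSqrt) b
    simp only [wordOp_cons, wordOp_nil] at h
    rw [h, List.length_cons, pow_succ, mul_assoc]
    refine mul_le_mul' le_rfl ?_
    cases c
    · simp only [letterOp, Bool.false_eq_true, if_false]
      exact mul_le_mul' ((recip_le_one b).trans one_le_two) le_rfl
    · exact letterOp_true_invSqrt_le hb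

lemma pairing_one_wordOp_ne_top (w : List Bool) {ρ : ℕ → ℝ≥0∞} {c : ℝ≥0∞} (hc : c ≠ ⊤)
    (hρ : ∀ k, 0 < k → ρ k ≤ c) : pairing 1 (wordOp w fun m => recip m * ρ m) ≠ ⊤ := by
  have h1 : ∀ k, 0 < k → recip k * ρ k ≤ c * invSqrt k := fun k hk => by
    rw [mul_comm]
    refine mul_le_mul' (hρ k hk) (ENNReal.ofReal_le_ofReal ?_)
    have hk' : (1 : ℝ) ≤ k := by exact_mod_cast hk
    rw [one_div]
    gcongr
    rw [Real.sqrt_le_left (by positivity)]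
    nlinarith
  have h2 : ∀ k, 0 < k → wordOp w (fun m => recip m * ρ m) k ≤
      c * 2 ^ w.length * invSqrt k := fun k hk => by
    refine (wordOp_le w h1 hk).trans ?_
    rw [wordOp_const_mul, mul_assoc]
    exact mul_le_mul' le_rfl (wordOp_invSqrt_le w hk)
  -- The term `k = 1` is split off because the bound on `letterOp true invSqrt` needs `b > 0`:
  -- division by zero makes `invSqrt 0 = 0`.
  have h3 : pairing 1 invSqrt ≤ 1 + 2 * invSqrt 1 := by
    have e : pairing 1 invSqrt = recip 1 * invSqrt 1 + letterOp true invSqrt 1 := by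
      rw [pairing, ENNReal.tsum_eq_add_tsum_ite 1]
      simp only [letterOp, if_true, Pi.one_apply, one_mul, zero_lt_one]
      congr 1
      refine tsum_congr fun k => ?_
      rcases k with _ | _ | k <;> simp
    rw [e]
    refine add_le_add ?_ (letterOp_true_invSqrt_le one_pos)
    simp [recip, invSqrt]
  refine ((pairing_le 1 h2).trans_lt ?_).ne
  rw [pairing_const_mul]
  refine ENNReal.mul_lt_top (ENNReal.mul_lt_top hc.lt_top (by finiteness)) (h3.trans_lt ?_)
  have : invSqrt 1 ≠ ⊤ := ENNReal.ofReal_ne_top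
  finiteness

/-! ### Comparison of coefficients -/

lemma tsum_pow_mul_succ (τ : ℝ≥0∞) (c : ℕ → ℝ≥0∞) :
    ∑' n, τ ^ n * c n = c 0 + τ * ∑' n, τ ^ n * c (n + 1) := by
  rw [tsum_eq_zero_add' ENNReal.summable, ← ENNReal.tsum_mul_left, pow_zero, one_mul]
  congr 1
  exact tsum_congr fun n => by ring

/-- Let `t → 0⁺` in `a 0 ≤ b 0 + t K`, with `K` the shifted series at `t = 1/4`. -/
lemma coeff_zero_le {a b : ℕ → ℝ≥0∞}
    (h : ∀ t : ℝ, 0 < t → t < 1 / 2 →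
      ∑' n, ENNReal.ofReal t ^ n * a n = ∑' n, ENNReal.ofReal t ^ n * b n)
    (hfin : ∀ t : ℝ, 0 < t → t < 1 / 2 → ∑' n, ENNReal.ofReal t ^ n * b n ≠ ⊤) : a 0 ≤ b 0 := by
  set K := ∑' n, ENNReal.ofReal (1 / 4) ^ n * b (n + 1) with hK
  have hKtop : K ≠ ⊤ := by
    intro hKt
    have h1 := hfin (1 / 4) (by norm_num) (by norm_num)
    rw [tsum_pow_mul_succ, ← hK, hKt, ENNReal.mul_top (by simp)] at h1
    simp at h1
  have hle : ∀ t : ℝ, 0 < t → t ≤ 1 / 4 → a 0 ≤ b 0 + ENNReal.ofReal t * K := fun t ht ht2 => by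
    calc a 0 ≤ ∑' n, ENNReal.ofReal t ^ n * a n := by
          simpa using ENNReal.le_tsum (f := fun n => ENNReal.ofReal t ^ n * a n) 0
      _ = b 0 + ENNReal.ofReal t * ∑' n, ENNReal.ofReal t ^ n * b (n + 1) := by
          rw [h t ht (by linarith), tsum_pow_mul_succ]
      _ ≤ _ := by
          gcongr
          exact ENNReal.tsum_le_tsum fun n => by gcongr
  have hlim : Tendsto (fun t : ℝ => b 0 + ENNReal.ofReal t * K) (𝓝[>] 0) (𝓝 (b 0 + 0 * K)) := by
    refine tendsto_const_nhds.add (ENNReal.Tendsto.mul_const ?_ (Or.inr hKtop))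
    have := (ENNReal.continuous_ofReal.tendsto 0).mono_left (nhdsWithin_le_nhds (s := Set.Ioi 0))
    simpa using this
  rw [zero_mul, add_zero] at hlim
  refine ge_of_tendsto hlim ?_
  filter_upwards [Ioc_mem_nhdsGT (show (0 : ℝ) < 1 / 4 by norm_num)] with t ht
  exact hle t ht.1 ht.2

/-- Once the constant terms agree and are finite, cancel them, divide by `t` and induct on the
shifted sequences. -/
lemma coeff_eq_of_genFun_eq {a b : ℕ → ℝ≥0∞}
    (h : ∀ t : ℝ, 0 < t → t < 1 / 2 →
      ∑' n, ENNReal.ofReal t ^ n * a n = ∑' n, ENNReal.ofReal t ^ n * b n)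
    (hfin : ∀ t : ℝ, 0 < t → t < 1 / 2 → ∑' n, ENNReal.ofReal t ^ n * b n ≠ ⊤) (n : ℕ) :
    a n = b n := by
  have h0 : a 0 = b 0 :=
    (coeff_zero_le h hfin).antisymm (coeff_zero_le (fun t ht ht2 => (h t ht ht2).symm)
      fun t ht ht2 => (h t ht ht2).trans_ne (hfin t ht ht2))
  induction n generalizing a b with
  | zero => exact h0
  | succ n ih =>
    have hb0 : b 0 ≠ ⊤ := by
      have := ENNReal.ne_top_of_tsum_ne_top (hfin (1 / 4) (by norm_num) (by norm_num)) 0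
      simpa using this
    have hs (t : ℝ) (ht : 0 < t) (ht2 : t < 1 / 2) :
        ∑' n, ENNReal.ofReal t ^ n * a (n + 1) = ∑' n, ENNReal.ofReal t ^ n * b (n + 1) := by
      have := h t ht ht2
      rw [tsum_pow_mul_succ _ a, tsum_pow_mul_succ _ b, h0] at this
      exact (ENNReal.mul_right_inj (by simpa using ht) ENNReal.ofReal_ne_top).1
        ((ENNReal.add_right_inj hb0).1 this)
    have hsfin (t : ℝ) (ht : 0 < t) (ht2 : t < 1 / 2) :
        ∑' n, ENNReal.ofReal t ^ n * b (n + 1) ≠ ⊤ := by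
      intro htop
      have := hfin t ht ht2
      rw [tsum_pow_mul_succ _ b, htop, ENNReal.mul_top (by simpa using ht)] at this
      simp at this
    exact ih hs hsfin ((coeff_zero_le hs hsfin).antisymm
      (coeff_zero_le (fun t ht ht2 => (hs t ht ht2).symm)
        fun t ht ht2 => (hs t ht ht2).trans_ne (hsfin t ht ht2)))

/-! ### The multiple series as sums in `ℝ≥0∞` -/

lemma summable_sigma_of_tsum_ne_top {ι : Type*} {κ : ι → Type*} {f : ι → ℝ} {g : ∀ i, κ i → ℝ}
    (hf : ∀ i, 0 ≤ f i) (hg : ∀ i j, 0 ≤ g i j)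
    (h : ∑' i, ENNReal.ofReal (f i) * ∑' j, ENNReal.ofReal (g i j) ≠ ⊤) :
    Summable fun p : (i : ι) × κ i => f p.1 * g p.1 p.2 := by
  have h' : ∑' p : (i : ι) × κ i, ENNReal.ofReal (f p.1 * g p.1 p.2) ≠ ⊤ := by
    rw [ENNReal.tsum_sigma']
    simpa only [ENNReal.ofReal_mul (hf _), ENNReal.tsum_mul_left] using h
  refine (ENNReal.summable_toReal h').congr fun p => ?_
  rw [ENNReal.toReal_ofReal (mul_nonneg (hf _) (hg _ _))]

lemma tsum_mul_tsum_eq_toReal {ι : Type*} {κ : ι → Type*} {f : ι → ℝ} {g : ∀ i, κ i → ℝ}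
    (hf : ∀ i, 0 ≤ f i) (hg : ∀ i j, 0 ≤ g i j)
    (h : ∑' i, ENNReal.ofReal (f i) * ∑' j, ENNReal.ofReal (g i j) ≠ ⊤) :
    ∑' i, f i * ∑' j, g i j =
      (∑' i, ENNReal.ofReal (f i) * ∑' j, ENNReal.ofReal (g i j)).toReal := by
  rw [ENNReal.tsum_toReal_eq (ENNReal.ne_top_of_tsum_ne_top h)]
  refine tsum_congr fun i => ?_
  rw [ENNReal.toReal_mul, ENNReal.toReal_ofReal (hf i),
    ENNReal.tsum_toReal_eq fun _ => ENNReal.ofReal_ne_top]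
  simp only [ENNReal.toReal_ofReal (hg i _)]

lemma term_nonneg (α : List ℕ) (k : Fin α.length → ℕ) : 0 ≤ term α k :=
  Finset.prod_nonneg fun _ _ => by positivity

/-- The multiple series over strict tuples `k` and tuples `l` in `I k`, in `ℝ≥0∞`. -/
def eSum (α β : List ℕ) (I : (Fin α.length → ℕ) → Set (Fin β.length → ℕ)) : ℝ≥0∞ :=
  ∑' k : StrictTuples α.length, ENNReal.ofReal (term α k) *
    ∑' l : I k.1, ENNReal.ofReal (term β l)

lemma eSum_spec {α β : List ℕ} {I : (Fin α.length → ℕ) → Set (Fin β.length → ℕ)}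
    (h : eSum α β I ≠ ⊤) :
    (Summable fun p : (k : StrictTuples α.length) × I k.1 => term α p.1 * term β p.2) ∧
    ∑' k : StrictTuples α.length, term α k * ∑' l : I k.1, term β l = (eSum α β I).toReal :=
  ⟨summable_sigma_of_tsum_ne_top (f := fun k : StrictTuples α.length => term α k)
      (g := fun k (l : I k.1) => term β l) (fun _ => term_nonneg _ _)
      (fun _ _ => term_nonneg _ _) h,
    tsum_mul_tsum_eq_toReal (f := fun k : StrictTuples α.length => term α k)
      (g := fun k (l : I k.1) => term β l) (fun _ => term_nonneg _ _)
      (fun _ _ => term_nonneg _ _) h⟩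

/-- If the inner sums have the generating function `φ(k₁) ρ(k_r)`, the generating function of the
multiple series is a pairing. -/
lemma tsum_pow_mul_eSum {a : ℕ} {α : List ℕ} {w : List Bool}
    (hα : ∀ x ∈ a :: α, 1 ≤ x) (hw : indexWord (a :: α) = true :: (w ++ [false])) (τ : ℝ≥0∞)
    (I : ∀ n, (Fin (a :: α).length → ℕ) → Set (Fin (List.replicate n 2).length → ℕ))
    (φ ρ : ℕ → ℝ≥0∞)
    (h : ∀ k ∈ StrictTuples (a :: α).length, ∑' n, τ ^ n * ∑' l : I n k,
      ENNReal.ofReal (term (List.replicate n 2) l.1) =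
        φ (k (0 : Fin (α.length + 1))) * ρ (k (Fin.last α.length))) :
    ∑' n, τ ^ n * eSum (a :: α) (List.replicate n 2) (I n) =
      pairing φ (wordOp w fun m => recip m * ρ m) := by
  rw [← tsum_strictTuples_eq_pairing φ ρ hα hw]
  simp only [eSum, ← ENNReal.tsum_mul_left]
  rw [ENNReal.tsum_comm]
  refine tsum_congr fun k => ?_
  rw [← h k.1 k.2, ← ENNReal.tsum_mul_left]
  refine tsum_congr fun n => ?_
  rw [ENNReal.tsum_mul_left, ENNReal.tsum_mul_left]
  ring

/-! ### Generating functions of the three series and their duality -/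

section GenFun

variable {t : ℝ} {a : ℕ} {α : List ℕ} {w : List Bool}

lemma genFun_U (ht : 0 < t) (ht2 : t < 1 / 2) (hα : ∀ x ∈ a :: α, 1 ≤ x)
    (hw : indexWord (a :: α) = true :: (w ++ [false])) :
    ∑' n, ENNReal.ofReal t ^ n *
        eSum (a :: α) (List.replicate n 2) (InnerU (List.replicate n 2).length) =
      pairing 1 (wordOp w fun m => recip m * ENNReal.ofReal (headProd t (m + 1))⁻¹) := by
  refine tsum_pow_mul_eSum hα hw _ _ _ _ fun k hk => ?_
  rw [Pi.one_apply, one_mul]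
  refine (tsum_congr fun n => congrArg _ (tsum_innerU (r := α.length) k n)).trans ?_
  have := genSum_invSqLe ht ht2 (m := k (Fin.last α.length)) le_rfl (by omega)
  rwa [headProd_one, one_div] at this

lemma genFun_L (ht : 0 < t) (ht2 : t < 1 / 2) (hα : ∀ x ∈ a :: α, 1 ≤ x)
    (hw : indexWord (a :: α) = true :: (w ++ [false])) :
    ∑' n, ENNReal.ofReal t ^ n *
        eSum (a :: α) (List.replicate n 2) (InnerL (List.replicate n 2).length) =
      pairing (fun b => ENNReal.ofReal (tailProd t b)) (wordOp w recip) := by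
  have h := tsum_pow_mul_eSum hα hw (ENNReal.ofReal t)
    (fun n => InnerL (List.replicate n 2).length) (fun b => ENNReal.ofReal (tailProd t b)) 1
    fun k hk => by
      have hk0 : 1 ≤ k (0 : Fin (α.length + 1)) := hk.1 _
      rw [Pi.one_apply, mul_one, ofReal_tailProd ht ht2 hk0]
      exact tsum_congr fun n => congrArg _ (tsum_innerL (r := α.length) k hk0 n)
  simpa using h

lemma genFun_B (ht : 0 < t) (ht2 : t < 1 / 2) (hα : ∀ x ∈ a :: α, 1 ≤ x)
    (hw : indexWord (a :: α) = true :: (w ++ [false])) :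
    ∑' n, ENNReal.ofReal t ^ n *
        eSum (a :: α) (List.replicate n 2) (InnerB (List.replicate n 2).length) =
      pairing (fun b => ENNReal.ofReal (headProd t b))
        (wordOp w fun m => recip m * ENNReal.ofReal (headProd t (m + 1))⁻¹) := by
  refine tsum_pow_mul_eSum hα hw _ _ _ _ fun k hk => ?_
  have hk0 : 1 ≤ k (0 : Fin (α.length + 1)) := hk.1 _
  refine (tsum_congr fun n => congrArg _ (tsum_innerB (r := α.length) k hk0 n)).trans ?_
  rw [← ENNReal.ofReal_mul (headProd_pos ht ht2 _).le, ← div_eq_mul_inv]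
  have hle : k (0 : Fin (α.length + 1)) ≤ k (Fin.last α.length) :=
    hk.2.monotone (Fin.zero_le (Fin.last α.length))
  exact genSum_invSqLe ht ht2 hk0 (by omega)

/-- The weight at `k_r` is a partial product, bounded by the convergent full product. -/
lemma genFun_U_ne_top (ht : 0 < t) (ht2 : t < 1 / 2) (w : List Bool) :
    pairing 1 (wordOp w fun m => recip m * ENNReal.ofReal (headProd t (m + 1))⁻¹) ≠ ⊤ := by
  refine pairing_one_wordOp_ne_top w (genSum_invSq_ne_top ht ht2 le_rfl) fun k _ => ?_
  have h := genSum_invSqLe ht ht2 (m := k) le_rfl (by omega)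
  rw [headProd_one, one_div] at h
  rw [← h]
  exact genSum_mono _ (invSqLe_le k) le_rfl

lemma headProd_le_one (ht : 0 < t) (ht2 : t < 1 / 2) (b : ℕ) : headProd t b ≤ 1 :=
  Finset.prod_le_one (fun _ hl => (one_sub_div_sq_pos ht ht2 (Finset.mem_Ico.1 hl).1).le)
    fun _ _ => sub_le_self _ (by positivity)

lemma genFun_B_ne_top (ht : 0 < t) (ht2 : t < 1 / 2) (w : List Bool) :
    pairing (fun b => ENNReal.ofReal (headProd t b))
      (wordOp w fun m => recip m * ENNReal.ofReal (headProd t (m + 1))⁻¹) ≠ ⊤ := by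
  refine ((ENNReal.tsum_le_tsum fun k => ?_).trans_lt (genFun_U_ne_top ht ht2 w).lt_top).ne
  refine mul_le_mul' ?_ le_rfl
  split_ifs
  · exact mul_le_mul' (ENNReal.ofReal_le_one.2 (headProd_le_one ht ht2 k)) le_rfl
  · exact le_rfl

lemma pairing_tailProd_econn (ht : 0 < t) (ht2 : t < 1 / 2) {m : ℕ} (hm : 0 < m) :
    pairing (fun b => ENNReal.ofReal (tailProd t b)) (econn m) =
      recip m * ENNReal.ofReal (headProd t (m + 1))⁻¹ := by
  refine (tsum_congr fun b => ?_).trans (tsum_conn_tailProd ht ht2 hm)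
  rw [ite_mul, zero_mul, mul_assoc]
  rfl

lemma genFun_U_eq_L (ht : 0 < t) (ht2 : t < 1 / 2) (w : List Bool) :
    pairing 1 (wordOp w fun m => recip m * ENNReal.ofReal (headProd t (m + 1))⁻¹) =
      pairing (fun b => ENNReal.ofReal (tailProd t b)) (wordOp (dualWord w) recip) := by
  have h := pairing_wordOp_duality 1 (fun b => ENNReal.ofReal (tailProd t b)) w
  rw [pairing_congr 1 fun k hk =>
      wordOp_congr w (fun m hm => pairing_tailProd_econn ht ht2 hm) hk,
    pairing_congr _ fun k hk =>
      wordOp_congr (dualWord w) (fun n hn => pairing_one_econn hn) hk] at h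
  exact h

lemma pairing_tailProd (ht : 0 < t) (ht2 : t < 1 / 2) (ρ : ℕ → ℝ≥0∞) :
    pairing (fun b => ENNReal.ofReal (tailProd t b)) ρ =
      ENNReal.ofReal (tailProd t 1) * pairing (fun b => ENNReal.ofReal (headProd t b)) ρ := by
  rw [pairing, pairing, ← ENNReal.tsum_mul_left]
  refine tsum_congr fun k => ?_
  split_ifs with hk
  · rw [tailProd_eq ht ht2 hk, ENNReal.ofReal_mul (tailProd_nonneg _ _)]
    ring
  · simp

lemma genFun_B_eq_B (ht : 0 < t) (ht2 : t < 1 / 2) (w : List Bool) :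
    pairing (fun b => ENNReal.ofReal (headProd t b))
        (wordOp w fun m => recip m * ENNReal.ofReal (headProd t (m + 1))⁻¹) =
      pairing (fun b => ENNReal.ofReal (headProd t b))
        (wordOp (dualWord w) fun m => recip m * ENNReal.ofReal (headProd t (m + 1))⁻¹) := by
  have h := pairing_wordOp_duality (fun b => ENNReal.ofReal (tailProd t b))
    (fun b => ENNReal.ofReal (tailProd t b)) w
  rw [pairing_congr _ fun k hk =>
      wordOp_congr w (fun m hm => pairing_tailProd_econn ht ht2 hm) hk,
    pairing_congr _ fun k hk => wordOp_congr (dualWord w) (fun n hn =>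
      (congrArg _ (funext fun m => econn_comm m n)).trans (pairing_tailProd_econn ht ht2 hn)) hk,
    pairing_tailProd ht ht2, pairing_tailProd ht ht2] at h
  -- The common factor `tailProd t 1` is finite and at least `1`, so it cancels.
  refine (ENNReal.mul_right_inj ?_ ENNReal.ofReal_ne_top).1 h
  rw [ofReal_tailProd ht ht2 le_rfl]
  exact (zero_lt_one.trans_le (one_le_genSum _ _ _)).ne'

end GenFun

lemma coeff_ne_top {a : ℕ → ℝ≥0∞} {t : ℝ} (ht : 0 < t)
    (h : ∑' n, ENNReal.ofReal t ^ n * a n ≠ ⊤) (n : ℕ) : a n ≠ ⊤ := by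
  intro ha
  have := ENNReal.ne_top_of_tsum_ne_top h n
  rw [ha, ENNReal.mul_top (pow_ne_zero _ (by simpa using ht))] at this
  exact this rfl

end MZV

end

theorem theorem1p2 (α β : List ℕ) (h : MZV.IsDual α β) (n : ℕ) :
    (MZV.ConvergesU α (List.replicate n 2) ∧ MZV.ConvergesL β (List.replicate n 2) ∧
      MZV.ZU α (List.replicate n 2) = MZV.ZL β (List.replicate n 2)) ∧
    (MZV.ConvergesB α (List.replicate n 2) ∧ MZV.ConvergesB β (List.replicate n 2) ∧
      MZV.ZB α (List.replicate n 2) = MZV.ZB β (List.replicate n 2)) := by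
  obtain ⟨a, α, b, β, w, rfl, rfl, hα, hβ, hw, hw'⟩ := h.exists_word
  have hUL (t : ℝ) (ht : 0 < t) (ht2 : t < 1 / 2) :=
    (MZV.genFun_U ht ht2 hα hw).trans
      ((MZV.genFun_U_eq_L ht ht2 w).trans (MZV.genFun_L ht ht2 hβ hw').symm)
  have hBB (t : ℝ) (ht : 0 < t) (ht2 : t < 1 / 2) :=
    (MZV.genFun_B ht ht2 hα hw).trans
      ((MZV.genFun_B_eq_B ht ht2 w).trans (MZV.genFun_B ht ht2 hβ hw').symm)
  -- Finiteness for `L` is inherited from `U` through the identity in `ℝ≥0∞`.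
  have hL (t : ℝ) (ht : 0 < t) (ht2 : t < 1 / 2) :=
    (hUL t ht ht2).symm.trans_ne
      ((MZV.genFun_U ht ht2 hα hw).trans_ne (MZV.genFun_U_ne_top ht ht2 w))
  have hB (t : ℝ) (ht : 0 < t) (ht2 : t < 1 / 2) :=
    (MZV.genFun_B ht ht2 hβ hw').trans_ne (MZV.genFun_B_ne_top ht ht2 (MZV.dualWord w))
  have eUL := MZV.coeff_eq_of_genFun_eq hUL hL n
  have eBB := MZV.coeff_eq_of_genFun_eq hBB hB n
  have fL := MZV.coeff_ne_top (by norm_num) (hL (1 / 4) (by norm_num) (by norm_num)) n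
  have fB := MZV.coeff_ne_top (by norm_num) (hB (1 / 4) (by norm_num) (by norm_num)) n
  obtain ⟨sU, vU⟩ := MZV.eSum_spec (eUL.trans_ne fL)
  obtain ⟨sL, vL⟩ := MZV.eSum_spec fL
  obtain ⟨sB, vB⟩ := MZV.eSum_spec (eBB.trans_ne fB)
  obtain ⟨sB', vB'⟩ := MZV.eSum_spec fB
  exact ⟨⟨sU, sL, vU.trans ((congrArg _ eUL).trans vL.symm)⟩,
    ⟨sB, sB', vB.trans ((congrArg _ eBB).trans vB'.symm)⟩⟩
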